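/- All graphs are finite and simple, $K_s$ is the complete graph on $s$ vertices, $\alpha(G)$ is the independence number of $G$, and logarithms are to base $2$. For positive integers $t,m$ let $R(t,m)$ be the least $n$ such that every graph on $n$ vertices contains a $K_t$ or an independent set of size $m$. For $t\ge 2$ and real $x\ge 0$ let $Q(t,x)$ be the minimum of $\alpha(G)$ over all $K_t$-free graphs $G$ on $\lceil x\rceil$ vertices. For a graph $H$ and a function $g$ let $\mathrm{RT}(n,H,g(n))$ be the maximum number of edges of an $H$-free graph $G$ on $n$ vertices with $\alpha(G)<g(n)$ (and $0$ if there is no such graph). Let $\overline{\varrho}(H,g)$ and $\underline{\varrho}(H,g)$ be the $\limsup$ and the $\liminf$ of $\mathrm{RT}(n,H,g(n))/n^2$ as $n\to\infty$; if they are equal, their common value is denoted $\varrho(H,g)$. Let $p\ge 3$ and $q\ge 2$ be integers, let $\omega(n)\to\infty$, and let $$f(n)=n\,2^{-\omega(n)(\log n)^{(q-2)/(q-1)}} .$$ Consider the condition $$(\ast)\qquad\text{there is a constant }\vartheta>0\text{ such that } R\bigl(p-1,Q(p,f(n))\bigr)<n^{1-\vartheta}\text{ for all sufficiently large } n.$$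 (a) If $(\ast)$ holds, then $$\overline{\varrho}\bigl(K_{pq-1},Q(p,f)\bigr)\le\frac12\left(1-\frac1{q-1}\right).$$ (b) Let $1\le i\le p-1$ and $t=\left\lfloor\frac{pq-i-1}{q-1}\right\rfloor$; then $t\ge p$. Let $g$ be a function with $$Q\left(t+1,\frac n{q-1}\right)<g(n)\le Q\bigl(p,f(n)\bigr)$$ for all sufficiently large $n$. Then $\underline{\varrho}(K_{pq-i},g)\ge\frac12\left(1-\frac1{q-1}\right)$, and if $(\ast)$ holds, then $\varrho(K_{pq-i},g)$ exists and $$\varrho(K_{pq-i},g)=\frac12\left(1-\frac1{q-1}\right).$$ -/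

import Mathlib

open Filter

noncomputable section

namespace RamseyTuran

/-- The Ramsey number `R(t, m)`: the least `n` such that every graph on `n` vertices contains
a clique of size `t` or an independent set of size `m`. -/
def ramseyNum (t m : ℕ) : ℕ :=
  sInf {n : ℕ | ∀ G : SimpleGraph (Fin n),
    (∃ S : Finset (Fin n), G.IsNClique t S) ∨ (∃ S : Finset (Fin n), G.IsNIndepSet m S)}

/-- The inverse Ramsey function `Q(t, x)`: the minimum independence number of a `K_t`-free graph
on `x` vertices. A real argument is rounded up to an integer. -/
def invRamsey (t : ℕ) (x : ℝ) : ℕ :=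
  sInf {a : ℕ | ∃ G : SimpleGraph (Fin ⌈x⌉₊), G.CliqueFree t ∧ G.indepNum = a}

/-- The Ramsey–Turán number `RT(n, H, m)`: the maximum number of edges of an `H`-free graph on
`n` vertices whose independence number is less than `m` (and `0` if there is no such graph). -/
def rtNum {W : Type*} (n : ℕ) (H : SimpleGraph W) (m : ℝ) : ℕ :=
  sSup {e : ℕ | ∃ G : SimpleGraph (Fin n),
    H.Free G ∧ (G.indepNum : ℝ) < m ∧ G.edgeSet.ncard = e}

/-- The upper Ramsey–Turán density of `H` with respect to `f`. The sequence takes its values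
in `[0, 1/2]`, so that the real `limsup` is the usual one. -/
def upperDensity {W : Type*} (H : SimpleGraph W) (f : ℕ → ℝ) : ℝ :=
  limsup (fun n : ℕ => (rtNum n H (f n) : ℝ) / (n : ℝ) ^ 2) atTop

/-- The lower Ramsey–Turán density of `H` with respect to `f`. -/
def lowerDensity {W : Type*} (H : SimpleGraph W) (f : ℕ → ℝ) : ℝ :=
  liminf (fun n : ℕ => (rtNum n H (f n) : ℝ) / (n : ℝ) ^ 2) atTop

/-- The Ramsey–Turán density of `H` with respect to `f` exists and equals `c`. -/
def HasDensity {W : Type*} (H : SimpleGraph W) (f : ℕ → ℝ) (c : ℝ) : Prop :=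
  upperDensity H f = c ∧ lowerDensity H f = c

/-- The function `f(n) = n * 2 ^ (-ω(n) * (log n) ^ ((q - 2) / (q - 1)))`, logarithm to base 2. -/
def fFun (q : ℕ) (ω : ℕ → ℝ) (n : ℕ) : ℝ :=
  (n : ℝ) * (2 : ℝ) ^ (-(ω n * (Real.logb 2 (n : ℝ)) ^ (((q : ℝ) - 2) / ((q : ℝ) - 1))))

/-- There is a constant `ϑ > 0` such that `R(p - 1, Q(p, f(n))) < n ^ (1 - ϑ)` for all
sufficiently large `n`. -/
def RamseyGap (p : ℕ) (f : ℕ → ℝ) : Prop :=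
  ∃ ϑ : ℝ, 0 < ϑ ∧ ∀ᶠ n : ℕ in atTop,
    (ramseyNum (p - 1) (invRamsey p (f n)) : ℝ) < (n : ℝ) ^ (1 - ϑ)

end RamseyTuran

end

/-!
Lower bound: join `q - 1` copies of an extremal `K_{t+1}`-free graph on `⌈n / (q - 1)⌉` vertices and
keep `n` of the vertices. A clique has at most `t` vertices in each copy, an independent set lies
within one copy.

Upper bound: above the density `1 - 1 / (q - 1)`, the Moon–Moser inequality yields a positive
proportion of ordered `q`-cliques among all `q`-tuples of vertices. If `δ_j n ^ (j + 1)` ordered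
`(j + 1)`-cliques are given, dependent random choice on their first coordinates, with `s_j` samples
among the remaining `j` coordinates, finds a set `U` of about `δ_j ^ s_j n ≥ f(n)` vertices in which
any `p` vertices extend to `δ_{j-1} n ^ j` common `j`-tuples. As `α(G) < Q(p, f(n))`, the set `U`
spans a `K_p`, and the argument is repeated with its common tuples. After `q - 1` rounds at least
`δ_0 n ≥ n ^ (1 - ϑ) > R(p - 1, Q(p, f(n)))` vertices remain, and they span a `K_{p-1}`; together
with the `q - 1` copies of `K_p` it forms a `K_{pq-1}`. Balancing `δ_j` against `δ_{j-1}` forces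
`log (1 / δ_j)` to grow by a factor of order `(log n) ^ (1 / (q - 1))` in each round; this is where
the exponent `(q - 2) / (q - 1)` in `f` comes from.
-/

namespace RamseyTuran

open Finset Topology

section Cliques

variable {V W : Type*} {G : SimpleGraph V}

lemma isNClique_union [DecidableEq V] {a b : ℕ} {S T : Finset V} (hS : G.IsNClique a S)
    (hT : G.IsNClique b T) (hST : ∀ v ∈ S, ∀ w ∈ T, G.Adj v w) : G.IsNClique (a + b) (S ∪ T) := by
  have hdisj : Disjoint S T := disjoint_left.2 fun v hvS hvT => (hST v hvS v hvT).ne rfl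
  refine ⟨?_, by rw [card_union_of_disjoint hdisj, hS.card_eq, hT.card_eq]⟩
  rw [coe_union, SimpleGraph.isClique_iff, Set.pairwise_union]
  exact ⟨hS.isClique, hT.isClique, fun v hv w hw _ => ⟨hST v hv w hw, (hST v hv w hw).symm⟩⟩

lemma indepNum_comap_le [Finite V] (G : SimpleGraph V) (e : W ↪ V) :
    (G.comap e).indepNum ≤ G.indepNum := by
  have : Finite W := Finite.of_injective e e.injective
  obtain ⟨S, hS⟩ := (G.comap e).exists_isNIndepSet_indepNum
  rw [← hS.card_eq, ← card_map e]
  refine SimpleGraph.IsIndepSet.card_le_indepNum ?_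
  rw [coe_map, SimpleGraph.isIndepSet_iff, e.injective.injOn.pairwise_image]
  exact hS.isIndepSet

/-- Every set of at least `x` vertices spans a `K_k`. In terms of the `K_k`-independence number
`α_k(G)`, the largest size of a vertex set spanning no `K_k`, this says `α_k(G) < x`. -/
def LargeSetsSpanClique (G : SimpleGraph V) (k : ℕ) (x : ℝ) : Prop :=
  ∀ U : Finset V, x ≤ #U → ∃ S ⊆ U, G.IsNClique k S

lemma LargeSetsSpanClique.mono {k : ℕ} {x y : ℝ} (hG : LargeSetsSpanClique G k x) (hxy : x ≤ y) :
    LargeSetsSpanClique G k y :=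
  fun U hU => hG U (hxy.trans hU)

lemma largeSetsSpanClique_of_comap {k N : ℕ} {x : ℝ} (hN : N ≤ ⌈x⌉₊)
    (hG : ∀ e : Fin N ↪ V, ¬ (G.comap e).CliqueFree k) : LargeSetsSpanClique G k x := by
  intro U hU
  obtain ⟨e⟩ : Nonempty (Fin N ↪ U) :=
    Function.Embedding.nonempty_of_card_le (by simpa using hN.trans (Nat.ceil_le.2 hU))
  obtain ⟨S, hS⟩ := not_forall_not.1 (hG (e.trans (.subtype _)))
  refine ⟨S.map (e.trans (.subtype _)), fun v hv => ?_,
    hS.map.mono (SimpleGraph.map_comap_le _ _)⟩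
  obtain ⟨i, -, rfl⟩ := mem_map.1 hv
  exact (e i).2

end Cliques

section Ramsey

variable {V : Type*} {G : SimpleGraph V}

lemma exists_isNClique_succ_of_subset_nbrs {k : ℕ} {v : V} {S U : Finset V}
    [DecidablePred (G.Adj v)] (hv : v ∈ U) (hSU : S ⊆ {w ∈ U | G.Adj v w})
    (hS : G.IsNClique k S) : ∃ T ⊆ U, G.IsNClique (k + 1) T := by
  classical
  exact ⟨insert v S, insert_subset hv (hSU.trans (filter_subset _ _)),
    hS.insert fun _ hw => (mem_filter.1 (hSU hw)).2⟩

lemma card_eq_card_nbrs_add_card_compl_nbrs {v : V} {U : Finset V} [DecidablePred (G.Adj v)]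
    [DecidablePred (Gᶜ.Adj v)] (hv : v ∈ U) :
    #U = #{w ∈ U | G.Adj v w} + #{w ∈ U | Gᶜ.Adj v w} + 1 := by
  classical
  have hcompl : {w ∈ U | ¬ G.Adj v w} = insert v {w ∈ U | Gᶜ.Adj v w} := by
    ext w
    simp only [mem_filter, mem_insert, SimpleGraph.compl_adj]
    grind [G.irrefl]
  rw [← card_filter_add_card_filter_not (G.Adj v), hcompl, card_insert_of_notMem (by simp),
    add_assoc]

/-- The Erdős–Szekeres form of **Ramsey's theorem**. -/
theorem exists_isNClique_or_isNIndepSet (s t : ℕ) {U : Finset V} (hU : (s + t).choose s ≤ #U) :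
    (∃ S ⊆ U, G.IsNClique s S) ∨ ∃ S ⊆ U, G.IsNIndepSet t S := by
  classical
  simp only [← SimpleGraph.isNClique_compl]
  induction s generalizing t U with
  | zero => exact .inl ⟨∅, by simp, by simp⟩
  | succ s ihs =>
    induction t generalizing U with
    | zero => exact .inr ⟨∅, by simp, by simp⟩
    | succ t iht =>
      have hpascal : (s + 1 + (t + 1)).choose (s + 1)
          = (s + (t + 1)).choose s + (s + 1 + t).choose (s + 1) := by
        rw [show s + 1 + (t + 1) = s + (t + 1) + 1 by omega, Nat.choose_succ_succ]
        congr 2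
        omega
      obtain ⟨v, hv⟩ : U.Nonempty :=
        card_pos.1 ((Nat.choose_pos (Nat.le_add_right _ _)).trans_le hU)
      have hcard := card_eq_card_nbrs_add_card_compl_nbrs (G := G) hv
      rcases le_or_gt ((s + (t + 1)).choose s) #{w ∈ U | G.Adj v w} with hnbrs | hnbrs
      · rcases ihs (t + 1) hnbrs with ⟨S, hSU, hS⟩ | ⟨S, hSU, hS⟩
        · exact .inl (exists_isNClique_succ_of_subset_nbrs hv hSU hS)
        · exact .inr ⟨S, hSU.trans (filter_subset _ _), hS⟩
      · rcases iht (U := {w ∈ U | Gᶜ.Adj v w}) (by omega) with ⟨S, hSU, hS⟩ | ⟨S, hSU, hS⟩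
        · exact .inl ⟨S, hSU.trans (filter_subset _ _), hS⟩
        · exact .inr (exists_isNClique_succ_of_subset_nbrs hv hSU hS)

lemma exists_isNClique_or_isNIndepSet_of_ramseyNum (t m : ℕ)
    (G : SimpleGraph (Fin (ramseyNum t m))) :
    (∃ S, G.IsNClique t S) ∨ ∃ S, G.IsNIndepSet m S := by
  refine Nat.sInf_mem (s := {n : ℕ | ∀ G : SimpleGraph (Fin n),
    (∃ S, G.IsNClique t S) ∨ ∃ S, G.IsNIndepSet m S}) ⟨(t + m).choose t, fun G => ?_⟩ G
  refine (exists_isNClique_or_isNIndepSet (G := G) t m (U := univ) (by simp)).imp ?_ ?_ <;>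
    exact fun ⟨S, _, hS⟩ => ⟨S, hS⟩

lemma largeSetsSpanClique_of_indepNum_lt [Finite V] {t m : ℕ} (hG : G.indepNum < m) :
    LargeSetsSpanClique G t (ramseyNum t m) := by
  refine largeSetsSpanClique_of_comap (Nat.ceil_natCast _).ge fun e hfree => ?_
  obtain ⟨S, hS⟩ | ⟨S, hS⟩ := exists_isNClique_or_isNIndepSet_of_ramseyNum t m (G.comap e)
  · exact hfree S hS
  · have hm : m ≤ (G.comap e).indepNum := hS.card_eq.ge.trans hS.isIndepSet.card_le_indepNum
    exact (hm.trans (indepNum_comap_le G e)).not_gt hG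

lemma largeSetsSpanClique_of_indepNum_lt_invRamsey [Finite V] {p : ℕ} {x : ℝ}
    (hG : G.indepNum < invRamsey p x) : LargeSetsSpanClique G p x :=
  largeSetsSpanClique_of_comap le_rfl fun e hfree =>
    (((Nat.sInf_le ⟨_, hfree, rfl⟩ : invRamsey p x ≤ (G.comap e).indepNum).trans
      (indepNum_comap_le G e)).not_gt hG)

lemma exists_cliqueFree_indepNum_eq_invRamsey {t : ℕ} (ht : 2 ≤ t) (x : ℝ) :
    ∃ G : SimpleGraph (Fin ⌈x⌉₊), G.CliqueFree t ∧ G.indepNum = invRamsey t x :=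
  Nat.sInf_mem (s := {a : ℕ | ∃ G : SimpleGraph (Fin ⌈x⌉₊), G.CliqueFree t ∧ G.indepNum = a})
    ⟨_, ⊥, SimpleGraph.cliqueFree_bot ht, rfl⟩

end Ramsey

section OrderedCliques

variable {V : Type*}

/-- `y` lists the vertices of a clique without repetition. Cliques are counted as tuples, so that
`K_k` contributes `k!`, because the induction splits off one coordinate at a time. -/
def IsCliqueTuple (G : SimpleGraph V) {k : ℕ} (y : Fin k → V) : Prop :=
  Pairwise fun i j => G.Adj (y i) (y j)

variable {G : SimpleGraph V}

lemma isCliqueTuple_insertNth {k : ℕ} (i : Fin (k + 1)) (v : V) (y : Fin k → V) :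
    IsCliqueTuple G (i.insertNth v y) ↔ (∀ j, G.Adj v (y j)) ∧ IsCliqueTuple G y := by
  simp only [IsCliqueTuple, Pairwise, Fin.forall_iff_succAbove i, Fin.insertNth_apply_same,
    Fin.insertNth_apply_succAbove, ne_eq, not_true_eq_false, false_imp_iff, true_and,
    Fin.succAbove_right_injective.eq_iff, Fin.ne_succAbove, Fin.succAbove_ne,
    not_false_eq_true, true_imp_iff, forall_and]
  grind [G.adj_comm]

lemma isCliqueTuple_cons {k : ℕ} (v : V) (y : Fin k → V) :
    IsCliqueTuple G (Fin.cons v y : Fin (k + 1) → V) ↔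
      (∀ j, G.Adj v (y j)) ∧ IsCliqueTuple G y := by
  rw [← Fin.insertNth_zero', isCliqueTuple_insertNth]

variable [Fintype V]

open Classical in
/-- The vertices related by `R` to every term of the family `f`. For `R = G.Adj` these are the
common neighbours in `G`; a bipartite `R` is used for dependent random choice. -/
noncomputable def commonNbrs {Y ι : Type*} (R : V → Y → Prop) (f : ι → Y) : Finset V :=
  {v | ∀ i, R v (f i)}

open Classical in
/-- The set of ordered `k`-cliques of `G`. -/
noncomputable def cliqueTuples (G : SimpleGraph V) (k : ℕ) : Finset (Fin k → V) :=
  {y | IsCliqueTuple G y}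

lemma mem_commonNbrs {Y ι : Type*} {R : V → Y → Prop} {f : ι → Y} {v : V} :
    v ∈ commonNbrs R f ↔ ∀ i, R v (f i) := by
  simp [commonNbrs]

lemma mem_cliqueTuples {k : ℕ} {y : Fin k → V} : y ∈ cliqueTuples G k ↔ IsCliqueTuple G y := by
  simp [cliqueTuples]

lemma sum_insertNth {M : Type*} [AddCommMonoid M] {k : ℕ} (i : Fin (k + 1))
    (F : (Fin (k + 1) → V) → M) : ∑ y, F y = ∑ v, ∑ z, F (i.insertNth v z) := by
  rw [← Fintype.sum_prod_type']
  exact (Fintype.sum_equiv (Fin.insertNthEquiv (fun _ => V) i) _ _ fun _ => rfl).symm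

lemma card_eq_sum_card_cons {k : ℕ} (T : Finset (Fin (k + 1) → V))
    [∀ v, DecidablePred fun z : Fin k → V => (Fin.cons v z : Fin (k + 1) → V) ∈ T] :
    #T = ∑ v, #{z : Fin k → V | (Fin.cons v z : Fin (k + 1) → V) ∈ T} := by
  classical
  calc #T = ∑ y, if y ∈ T then 1 else 0 := by simp
    _ = ∑ v, ∑ z, if (Fin.cons v z : Fin (k + 1) → V) ∈ T then 1 else 0 := by
      simp only [sum_insertNth 0, Fin.insertNth_zero']
    _ = ∑ v, #{z : Fin k → V | (Fin.cons v z : Fin (k + 1) → V) ∈ T} := by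
      simp only [card_filter]

lemma sum_cliqueTuples_succ (G : SimpleGraph V) {k : ℕ} (i : Fin (k + 1))
    (F : (Fin k → V) → ℕ) :
    ∑ y ∈ cliqueTuples G (k + 1), F (i.removeNth y)
      = ∑ z ∈ cliqueTuples G k, #(commonNbrs G.Adj z) * F z := by
  classical
  simp only [cliqueTuples, commonNbrs, sum_filter, card_filter, sum_mul]
  rw [sum_insertNth i, sum_comm]
  refine sum_congr rfl fun z _ => ?_
  by_cases hz : IsCliqueTuple G z <;> simp [isCliqueTuple_insertNth, hz]

lemma card_cliqueTuples_succ (G : SimpleGraph V) (k : ℕ) :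
    #(cliqueTuples G (k + 1)) = ∑ z ∈ cliqueTuples G k, #(commonNbrs G.Adj z) := by
  simpa using sum_cliqueTuples_succ G 0 fun _ => 1

lemma card_cliqueTuples_zero (G : SimpleGraph V) : #(cliqueTuples G 0) = 1 := by
  simp [cliqueTuples, IsCliqueTuple, Pairwise]

lemma card_cliqueTuples_one (G : SimpleGraph V) : #(cliqueTuples G 1) = Fintype.card V := by
  simp [cliqueTuples, IsCliqueTuple, Pairwise]

lemma card_cliqueTuples_two (G : SimpleGraph V) :
    #(cliqueTuples G 2) = 2 * G.edgeSet.ncard := by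
  classical
  rw [← SimpleGraph.coe_edgeFinset, Set.ncard_coe_finset, ← G.dart_card_eq_twice_card_edges,
    ← card_univ]
  refine (card_bij (fun d _ => ![d.fst, d.snd]) (fun d _ => ?_) (fun d _ d' _ h => ?_)
    fun y hy => ?_).symm
  · simp [mem_cliqueTuples, IsCliqueTuple, Pairwise, Fin.forall_fin_two, d.adj, d.adj.symm]
  · exact SimpleGraph.Dart.ext _ _ (Prod.ext (congrFun h 0) (congrFun h 1))
  · refine ⟨⟨(y 0, y 1), mem_cliqueTuples.1 hy zero_ne_one⟩, mem_univ _, ?_⟩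
    ext i
    fin_cases i <;> rfl

lemma sum_card_commonNbrs_removeNth_le {k : ℕ} (G : SimpleGraph V) (y : Fin (k + 1) → V) :
    ∑ i : Fin (k + 1), #(commonNbrs G.Adj (i.removeNth y))
      ≤ Fintype.card V + k * #(commonNbrs G.Adj y) := by
  classical
  have hcount : ∀ w, #{i : Fin (k + 1) | w ∈ commonNbrs G.Adj (i.removeNth y)}
      ≤ 1 + if w ∈ commonNbrs G.Adj y then k else 0 := by
    intro w
    split_ifs with hw
    · exact (card_le_univ _).trans (by simp [add_comm])
    · obtain ⟨j, hj⟩ : ∃ j, ¬ G.Adj w (y j) := by simpa [mem_commonNbrs] using hw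
      rw [add_zero, card_le_one_iff_subset_singleton]
      refine ⟨j, fun i hi => mem_singleton.2 (not_not.1 fun hij => hj ?_)⟩
      obtain ⟨l, rfl⟩ := Fin.exists_succAbove_eq (Ne.symm hij)
      exact mem_commonNbrs.1 (mem_filter.1 hi).2 l
  calc ∑ i : Fin (k + 1), #(commonNbrs G.Adj (i.removeNth y))
      = ∑ w, #{i : Fin (k + 1) | w ∈ commonNbrs G.Adj (i.removeNth y)} := by
        simp only [card_filter]
        rw [sum_comm]
        simp
    _ ≤ ∑ w, (1 + if w ∈ commonNbrs G.Adj y then k else 0) := sum_le_sum fun w _ => hcount w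
    _ = Fintype.card V + k * #(commonNbrs G.Adj y) := by
        simp [sum_add_distrib, mul_comm]

theorem moon_moser (G : SimpleGraph V) (k : ℕ) :
    (k + 1) * #(cliqueTuples G (k + 1)) ^ 2
      ≤ #(cliqueTuples G k) * (Fintype.card V * #(cliqueTuples G (k + 1))
        + k * #(cliqueTuples G (k + 2))) := by
  have hcauchy : #(cliqueTuples G (k + 1)) ^ 2
      ≤ #(cliqueTuples G k) * ∑ z ∈ cliqueTuples G k, #(commonNbrs G.Adj z) ^ 2 := by
    rw [card_cliqueTuples_succ]
    exact sq_sum_le_card_mul_sum_sq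
  have hcount : (k + 1) * ∑ z ∈ cliqueTuples G k, #(commonNbrs G.Adj z) ^ 2
      ≤ Fintype.card V * #(cliqueTuples G (k + 1)) + k * #(cliqueTuples G (k + 2)) :=
    calc (k + 1) * ∑ z ∈ cliqueTuples G k, #(commonNbrs G.Adj z) ^ 2
        = ∑ i : Fin (k + 1), ∑ y ∈ cliqueTuples G (k + 1),
            #(commonNbrs G.Adj (i.removeNth y)) := by
          simp [sum_cliqueTuples_succ G _ fun z => #(commonNbrs G.Adj z), sq]
      _ ≤ ∑ y ∈ cliqueTuples G (k + 1), (Fintype.card V + k * #(commonNbrs G.Adj y)) := by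
          rw [sum_comm]
          exact sum_le_sum fun y _ => sum_card_commonNbrs_removeNth_le G y
      _ = Fintype.card V * #(cliqueTuples G (k + 1)) + k * #(cliqueTuples G (k + 2)) := by
          rw [sum_add_distrib, ← mul_sum, ← card_cliqueTuples_succ, sum_const, smul_eq_mul,
            mul_comm]
  calc (k + 1) * #(cliqueTuples G (k + 1)) ^ 2
      ≤ (k + 1) * (#(cliqueTuples G k) * ∑ z ∈ cliqueTuples G k, #(commonNbrs G.Adj z) ^ 2) :=
        Nat.mul_le_mul_left _ hcauchy
    _ = #(cliqueTuples G k) * ((k + 1) * ∑ z ∈ cliqueTuples G k, #(commonNbrs G.Adj z) ^ 2) :=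
        Nat.mul_left_comm _ _ _
    _ ≤ _ := Nat.mul_le_mul_left _ hcount

lemma one_sub_mul_le_of_moon_moser {k n σ t₀ t₁ t₂ : ℝ} (hk : 0 < k) (ht₀ : 0 ≤ t₀)
    (ht₁ : 0 ≤ t₁) (ht₂ : 0 ≤ t₂) (hmm : (k + 1) * t₁ ^ 2 ≤ t₀ * (n * t₁ + k * t₂))
    (ht : (1 - k * σ) * (n * t₀) ≤ t₁) : (1 - (k + 1) * σ) * (n * t₁) ≤ t₂ := by
  obtain rfl | ht₁ := ht₁.eq_or_lt
  · simpa using ht₂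
  obtain rfl | ht₀ := ht₀.eq_or_lt
  · rw [zero_mul] at hmm
    exact absurd hmm (not_le.2 (by positivity))
  have hstep : t₀ * (k * ((1 - (k + 1) * σ) * (n * t₁))) ≤ t₀ * (k * t₂) :=
    calc t₀ * (k * ((1 - (k + 1) * σ) * (n * t₁)))
        = (k + 1) * t₁ * ((1 - k * σ) * (n * t₀)) - t₀ * (n * t₁) := by ring
      _ ≤ (k + 1) * t₁ * t₁ - t₀ * (n * t₁) := by gcongr
      _ ≤ t₀ * (k * t₂) := by linarith
  exact le_of_mul_le_mul_left (le_of_mul_le_mul_left hstep ht₀) hk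

lemma one_sub_mul_card_cliqueTuples_le {σ : ℝ}
    (hG : (1 - σ) * (Fintype.card V : ℝ) ^ 2 ≤ #(cliqueTuples G 2)) (k : ℕ) :
    (1 - k * σ) * (Fintype.card V * #(cliqueTuples G k)) ≤ #(cliqueTuples G (k + 1)) := by
  induction k with
  | zero => simp [card_cliqueTuples_zero, card_cliqueTuples_one]
  | succ k ih =>
    obtain rfl | hk := Nat.eq_zero_or_pos k
    · simpa [card_cliqueTuples_one, sq] using hG
    push_cast
    exact one_sub_mul_le_of_moon_moser (mod_cast hk) (Nat.cast_nonneg _) (Nat.cast_nonneg _)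
      (Nat.cast_nonneg _) (mod_cast moon_moser G k) ih

/-- **Supersaturation**: for `σ < 1 / r`, that is, above the density of the `r`-partite Turán graph,
a positive proportion of all `(r + 1)`-tuples are cliques. -/
theorem one_sub_pow_mul_card_pow_le_card_cliqueTuples {r : ℕ} {σ : ℝ} (hσ : 0 ≤ σ)
    (hrσ : r * σ ≤ 1) (hG : (1 - σ) * (Fintype.card V : ℝ) ^ 2 ≤ #(cliqueTuples G 2)) :
    (1 - r * σ) ^ (r + 1) * (Fintype.card V : ℝ) ^ (r + 1) ≤ #(cliqueTuples G (r + 1)) := by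
  have hchain : ∀ k ≤ r + 1,
      ((1 - r * σ) * (Fintype.card V : ℝ)) ^ k ≤ #(cliqueTuples G k) := by
    intro k hk
    induction k with
    | zero => simp [card_cliqueTuples_zero]
    | succ k ih =>
      have hkr : (k : ℝ) ≤ r := mod_cast Nat.le_of_succ_le_succ hk
      calc ((1 - r * σ) * (Fintype.card V : ℝ)) ^ (k + 1)
          = (1 - r * σ) * (Fintype.card V * ((1 - r * σ) * (Fintype.card V : ℝ)) ^ k) := by ring
        _ ≤ (1 - k * σ) * (Fintype.card V * #(cliqueTuples G k)) := by
            have := ih (by omega)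
            have : 0 ≤ 1 - r * σ := by linarith
            have : r * σ ≥ k * σ := by gcongr
            have : 0 ≤ 1 - k * σ := by linarith
            gcongr
        _ ≤ #(cliqueTuples G (k + 1)) := one_sub_mul_card_cliqueTuples_le hG k
  rw [← mul_pow]
  exact hchain _ le_rfl

end OrderedCliques

section DependentRandomChoice

variable {V Y : Type*}

lemma card_mul_pow_le_sum_pow {ι : Type*} {A : Finset ι} {f : ι → ℝ} {a : ℝ} (ha : 0 ≤ a)
    (hf : ∀ i ∈ A, 0 ≤ f i) (h : #A * a ≤ ∑ i ∈ A, f i) (k : ℕ) :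
    #A * a ^ k ≤ ∑ i ∈ A, f i ^ k := by
  obtain rfl | hA := A.eq_empty_or_nonempty
  · simp
  obtain _ | k := k
  · simp
  have : (0 : ℝ) < #A := mod_cast hA.card_pos
  calc #A * a ^ (k + 1) = (#A * a) ^ (k + 1) / #A ^ k := by field_simp; ring
    _ ≤ (∑ i ∈ A, f i) ^ (k + 1) / #A ^ k := by gcongr
    _ ≤ ∑ i ∈ A, f i ^ (k + 1) := pow_sum_div_card_le_sum_pow hf k

lemma exists_subset_forall_not_subset [DecidableEq V] {B : Finset (Finset V)}
    (hB : ∀ S ∈ B, S.Nonempty) (U : Finset V) :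
    ∃ U' ⊆ U, #U ≤ #U' + #{S ∈ B | S ⊆ U} ∧ ∀ S ∈ B, ¬ S ⊆ U' := by
  obtain rfl | ⟨u, -⟩ := U.eq_empty_or_nonempty
  · exact ⟨∅, by simp, by simp, fun S hS hS0 => (hB S hS).ne_empty (subset_empty.1 hS0)⟩
  have : Nonempty V := ⟨u⟩
  choose! v hv using hB
  refine ⟨U \ {S ∈ B | S ⊆ U}.image v, sdiff_subset, ?_, fun S hS hSU' => ?_⟩
  · have hdiff := le_card_sdiff ({S ∈ B | S ⊆ U}.image v) U
    have himage : #({S ∈ B | S ⊆ U}.image v) ≤ #{S ∈ B | S ⊆ U} := card_image_le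
    omega
  · exact (mem_sdiff.1 (hSU' (hv S hS))).2
      (mem_image_of_mem v (mem_filter.2 ⟨hS, hSU'.trans sdiff_subset⟩))

variable [Fintype V] [Fintype Y] (R : V → Y → Prop)

open Classical in
lemma card_filter_subset_commonNbrs (s : ℕ) (S : Finset V) :
    #{f : Fin s → Y | S ⊆ commonNbrs R f} = #{y | ∀ v ∈ S, R v y} ^ s := by
  rw [← Fintype.card_piFinset_const]
  congr 1
  ext f
  simp only [mem_filter, mem_univ, true_and, Fintype.mem_piFinset, subset_iff, mem_commonNbrs]
  exact ⟨fun h i v hv => h hv i, fun h v hv i => h i v hv⟩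

open Classical in
lemma sum_card_filter_subset_commonNbrs (s : ℕ) (B : Finset (Finset V)) :
    ∑ f : Fin s → Y, #{S ∈ B | S ⊆ commonNbrs R f} = ∑ S ∈ B, #{y | ∀ v ∈ S, R v y} ^ s := by
  simp only [← card_filter_subset_commonNbrs]
  simp only [card_filter]
  exact sum_comm

open Classical in
lemma sum_card_commonNbrs (s : ℕ) :
    ∑ f : Fin s → Y, #(commonNbrs R f) = ∑ v, #{y | R v y} ^ s := by
  have hdeg : ∀ v, #{f : Fin s → Y | v ∈ commonNbrs R f} = #{y | R v y} ^ s := fun v => by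
    simpa using card_filter_subset_commonNbrs R s {v}
  simp only [← hdeg]
  simp only [card_filter]
  rw [sum_comm]
  simp

variable {R}

open Classical in
lemma pow_mul_le_sum_card_commonNbrs {δ : ℝ} (hδ : 0 ≤ δ)
    (hR : δ * Fintype.card V * Fintype.card Y ≤ ∑ v, (#{y | R v y} : ℝ)) (s : ℕ) :
    δ ^ s * Fintype.card V * (Fintype.card Y : ℝ) ^ s
      ≤ ∑ f : Fin s → Y, (#(commonNbrs R f) : ℝ) := by
  rw [← Nat.cast_sum, sum_card_commonNbrs]
  push_cast
  calc δ ^ s * Fintype.card V * (Fintype.card Y : ℝ) ^ s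
      = #(univ : Finset V) * (δ * Fintype.card Y) ^ s := by rw [card_univ]; ring
    _ ≤ ∑ v, (#{y | R v y} : ℝ) ^ s :=
      card_mul_pow_le_sum_pow (by positivity) (fun v _ => by positivity)
        (by rw [card_univ]; linarith) s

open Classical in
lemma sum_card_filter_subset_commonNbrs_le {B : Finset (Finset V)} {a : ℝ}
    (hB : ∀ S ∈ B, (#{y | ∀ v ∈ S, R v y} : ℝ) ≤ a) (s : ℕ) :
    ∑ f : Fin s → Y, (#{S ∈ B | S ⊆ commonNbrs R f} : ℝ) ≤ #B * a ^ s := by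
  rw [← Nat.cast_sum, sum_card_filter_subset_commonNbrs]
  push_cast
  calc ∑ S ∈ B, (#{y | ∀ v ∈ S, R v y} : ℝ) ^ s ≤ ∑ _ ∈ B, a ^ s := by
        gcongr with S hS
        exact hB S hS
    _ = #B * a ^ s := by rw [sum_const, nsmul_eq_mul]

open Classical in
/-- The common neighbourhood of `s` random elements of `Y` is large on average, while a `p`-set
with few common neighbours is unlikely to lie in it. -/
theorem dependent_random_choice [Nonempty Y] {p s : ℕ} {δ θ : ℝ} (hp : 0 < p) (hδ : 0 ≤ δ)
    (hθ : 0 ≤ θ) (hR : δ * Fintype.card V * Fintype.card Y ≤ ∑ v, (#{y | R v y} : ℝ)) :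
    ∃ U : Finset V, δ ^ s * Fintype.card V - (Fintype.card V).choose p * θ ^ s ≤ #U ∧
      ∀ S ⊆ U, #S = p → θ * Fintype.card Y ≤ #{y | ∀ v ∈ S, R v y} := by
  let B : Finset (Finset V) :=
    {S ∈ powersetCard p univ | (#{y | ∀ v ∈ S, R v y} : ℝ) < θ * Fintype.card Y}
  have hbad : ∑ f : Fin s → Y, (#{S ∈ B | S ⊆ commonNbrs R f} : ℝ)
      ≤ (Fintype.card V).choose p * θ ^ s * Fintype.card Y ^ s := by
    have hB : #B ≤ (Fintype.card V).choose p := by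
      simpa [card_powersetCard] using card_filter_le (powersetCard p (univ : Finset V)) _
    calc ∑ f : Fin s → Y, (#{S ∈ B | S ⊆ commonNbrs R f} : ℝ)
        ≤ #B * (θ * Fintype.card Y) ^ s :=
          sum_card_filter_subset_commonNbrs_le (fun S hS => (mem_filter.1 hS).2.le) s
      _ = #B * θ ^ s * Fintype.card Y ^ s := by rw [mul_pow, mul_assoc]
      _ ≤ (Fintype.card V).choose p * θ ^ s * Fintype.card Y ^ s := by gcongr
  obtain ⟨f, -, hf⟩ : ∃ f ∈ (univ : Finset (Fin s → Y)),
      δ ^ s * Fintype.card V - (Fintype.card V).choose p * θ ^ s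
        ≤ #(commonNbrs R f) - (#{S ∈ B | S ⊆ commonNbrs R f} : ℝ) := by
    refine exists_le_of_sum_le univ_nonempty ?_
    rw [sum_const, nsmul_eq_mul, sum_sub_distrib, card_univ, Fintype.card_fun, Fintype.card_fin]
    push_cast
    linarith [pow_mul_le_sum_card_commonNbrs hδ hR s]
  obtain ⟨U, -, hU, hBU⟩ := exists_subset_forall_not_subset (B := B) (fun S hS => card_pos.1 <|
    hp.trans_eq (mem_powersetCard.1 (mem_filter.1 hS).1).2.symm) (commonNbrs R f)
  have hU : (#(commonNbrs R f) : ℝ) ≤ #U + #{S ∈ B | S ⊆ commonNbrs R f} := mod_cast hU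
  refine ⟨U, by linarith, fun S hSU hS => not_lt.1 fun hlt => hBU S ?_ hSU⟩
  exact mem_filter.2 ⟨mem_powersetCard.2 ⟨subset_univ S, hS⟩, hlt⟩

end DependentRandomChoice

section IteratedDependentRandomChoice

variable {V : Type*} [Fintype V] [Nonempty V] {G : SimpleGraph V}

lemma exists_isNClique_forall_cons_mem {p r s : ℕ} {δ θ x : ℝ} (hp : 0 < p) (hδ : 0 ≤ δ)
    (hθ : 0 ≤ θ) (hG : LargeSetsSpanClique G p x)
    (hx : x ≤ δ ^ s * Fintype.card V - (Fintype.card V).choose p * θ ^ s)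
    {T : Finset (Fin (r + 1) → V)} (hT : δ * (Fintype.card V : ℝ) ^ (r + 1) ≤ #T) :
    ∃ (S : Finset V) (T' : Finset (Fin r → V)), G.IsNClique p S ∧
      θ * (Fintype.card V : ℝ) ^ r ≤ #T' ∧
      ∀ v ∈ S, ∀ z ∈ T', (Fin.cons v z : Fin (r + 1) → V) ∈ T := by
  classical
  obtain ⟨R, hR⟩ : ∃ R : V → (Fin r → V) → Prop,
      ∀ v z, R v z ↔ (Fin.cons v z : Fin (r + 1) → V) ∈ T := ⟨_, fun _ _ => Iff.rfl⟩
  have hdeg : δ * Fintype.card V * Fintype.card (Fin r → V) ≤ ∑ v, (#{z | R v z} : ℝ) := by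
    simp only [hR]
    rw [← Nat.cast_sum, ← card_eq_sum_card_cons, Fintype.card_fun, Fintype.card_fin]
    push_cast
    rwa [mul_assoc, ← pow_succ']
  obtain ⟨U, hU, hUT⟩ := dependent_random_choice (s := s) hp hδ hθ hdeg
  obtain ⟨S, hSU, hS⟩ := hG U (hx.trans hU)
  refine ⟨S, univ.filter fun z => ∀ v ∈ S, R v z, hS, ?_,
    fun v hv z hz => (hR v z).1 ((mem_filter.1 hz).2 v hv)⟩
  simpa only [Fintype.card_fun, Fintype.card_fin, Nat.cast_pow] using hUT S hSU hS.card_eq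

lemma exists_isNClique_of_dense_cliqueTuples {p k r : ℕ} {x x' : ℝ} {δ : ℕ → ℝ} {s : ℕ → ℕ}
    (hp : 0 < p) (hδ : ∀ j, 0 < δ j) (hGp : LargeSetsSpanClique G p x)
    (hGk : LargeSetsSpanClique G k x') (hx' : x' ≤ δ 0 * Fintype.card V)
    (hx : ∀ j < r, x ≤ δ (j + 1) ^ s j * Fintype.card V
      - (Fintype.card V).choose p * δ j ^ s j)
    {T : Finset (Fin (r + 1) → V)} (hT : T ⊆ cliqueTuples G (r + 1))
    (hTcard : δ r * (Fintype.card V : ℝ) ^ (r + 1) ≤ #T) :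
    ∃ C, G.IsNClique (p * r + k) C ∧ ∀ c ∈ C, ∃ y ∈ T, c ∈ Set.range y := by
  classical
  induction r with
  | zero =>
    have hinj : Function.Injective fun y : Fin 1 → V => y 0 := fun y z h => by
      ext i
      rwa [Subsingleton.elim i 0]
    obtain ⟨C, hCT, hC⟩ := hGk (T.image (· 0)) <| by
      rw [card_image_of_injective _ hinj]
      exact hx'.trans (by simpa using hTcard)
    refine ⟨C, by simpa using hC, fun c hc => ?_⟩
    obtain ⟨y, hy, rfl⟩ := mem_image.1 (hCT hc)
    exact ⟨y, hy, Set.mem_range_self 0⟩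
  | succ r ih =>
    obtain ⟨S, T', hS, hT'card, hcons⟩ := exists_isNClique_forall_cons_mem hp (hδ (r + 1)).le
      (hδ r).le hGp (hx r (Nat.lt_succ_self r)) hTcard
    have hadj : ∀ v ∈ S, ∀ z ∈ T', (∀ j, G.Adj v (z j)) ∧ IsCliqueTuple G z :=
      fun v hv z hz => (isCliqueTuple_cons v z).1 (mem_cliqueTuples.1 (hT (hcons v hv z hz)))
    obtain ⟨v₀, hv₀⟩ : S.Nonempty := card_pos.1 (hp.trans_eq hS.card_eq.symm)
    obtain ⟨z₀, hz₀⟩ : T'.Nonempty := by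
      refine card_pos.1 (Nat.cast_pos (α := ℝ).1 (lt_of_lt_of_le ?_ hT'card))
      have := hδ r
      positivity
    obtain ⟨C, hC, hCT⟩ := ih (fun j hj => hx j (hj.trans (Nat.lt_succ_self r)))
      (fun z hz => mem_cliqueTuples.2 (hadj v₀ hv₀ z hz).2) hT'card
    refine ⟨S ∪ C, ?_, fun c hc => ?_⟩
    · rw [show p * (r + 1) + k = p + (p * r + k) by ring]
      refine isNClique_union hS hC fun v hv c hc => ?_
      obtain ⟨z, hz, j, rfl⟩ := hCT c hc
      exact (hadj v hv z hz).1 j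
    · obtain hcS | hcC := mem_union.1 hc
      · exact ⟨_, hcons c hcS z₀ hz₀, 0, Fin.cons_zero _ _⟩
      · obtain ⟨z, hz, j, rfl⟩ := hCT c hcC
        exact ⟨_, hcons v₀ hv₀ z hz, j.succ, Fin.cons_succ _ _ _⟩

end IteratedDependentRandomChoice

section Parameters

lemma exists_sampleSize {y B M : ℝ} (hy : 2 ≤ y) (hB : 0 < B) (hM : 0 ≤ M) :
    ∃ s : ℕ, M ≤ s * (y * B - B) ∧ s * B ≤ 2 * M / y + B := by
  have : 0 < y := by linarith
  have hceil := Nat.le_ceil (2 * M / (y * B))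
  refine ⟨⌈2 * M / (y * B)⌉₊, ?_, ?_⟩
  · calc M = 2 * M / (y * B) * (y * B / 2) := by field_simp
      _ ≤ ⌈2 * M / (y * B)⌉₊ * (y * B - B) := by
        gcongr
        nlinarith
  · calc (⌈2 * M / (y * B)⌉₊ : ℝ) * B ≤ (2 * M / (y * B) + 1) * B := by
          gcongr
          exact (Nat.ceil_lt_add_one (by positivity)).le
      _ = 2 * M / y + B := by field_simp

-- The exponents form a geometric progression of ratio `κ * x` that descends from `a 0 ≤ ϑ * x ^ r`
-- to the constant `a r = A`, so that one round costs only `O(x ^ (r - 1))` in the exponent.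
lemma exists_exponents (p : ℕ) {r : ℕ} (hr : 1 ≤ r) {A ϑ : ℝ} (hA : 0 < A) (hϑ : 0 < ϑ) :
    ∃ C : ℝ, ∀ᶠ x : ℝ in atTop, ∃ (a : ℕ → ℝ) (s : ℕ → ℕ), a r = A ∧ a 0 ≤ ϑ * x ^ r ∧
      ∀ j < r, s j * a (j + 1) + 1 ≤ C * x ^ (r - 1) ∧
        1 + p * x ^ r ≤ s j * (a j - a (j + 1)) := by
  obtain ⟨κ, hκ, hκ1, hκA⟩ : ∃ κ : ℝ, 0 < κ ∧ κ ≤ 1 ∧ A * κ ≤ ϑ :=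
    ⟨min 1 (ϑ / A), by positivity, min_le_left _ _,
      (mul_le_mul_of_nonneg_left (min_le_right _ _) hA.le).trans_eq (by field_simp)⟩
  obtain ⟨m, rfl⟩ : ∃ m, r = m + 1 := ⟨r - 1, by omega⟩
  refine ⟨2 * (1 + p) / κ + A + 1, ?_⟩
  filter_upwards [eventually_ge_atTop (2 / κ), eventually_ge_atTop 1] with x hx hx1
  have hκx : 2 ≤ κ * x := by rwa [div_le_iff₀' hκ] at hx
  have hpow (j : ℕ) : 1 ≤ x ^ j := one_le_pow₀ hx1
  have hpowκ (j : ℕ) : 0 < (κ * x) ^ j := by positivity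
  choose s hs hsC using fun j : ℕ => exists_sampleSize (M := 1 + p * x ^ (m + 1)) hκx
    (mul_pos hA (hpowκ (m - j))) (by positivity)
  refine ⟨fun j => A * (κ * x) ^ (m + 1 - j), s, by simp, ?_, fun j hj => ?_⟩
  · calc A * (κ * x) ^ (m + 1) = A * κ * κ ^ m * x ^ (m + 1) := by ring
      _ ≤ ϑ * 1 * x ^ (m + 1) := by
        gcongr
        exact pow_le_one₀ hκ.le hκ1
      _ = ϑ * x ^ (m + 1) := by rw [mul_one]
  simp only [Nat.add_sub_add_right, Nat.add_sub_cancel]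
  constructor
  · have hgeom : (κ * x) ^ (m - j) ≤ x ^ m :=
      calc (κ * x) ^ (m - j) ≤ (1 * x) ^ (m - j) := by gcongr
        _ ≤ x ^ m := by
          rw [one_mul]
          exact pow_le_pow_right₀ hx1 (Nat.sub_le m j)
    calc s j * (A * (κ * x) ^ (m - j)) + 1
        ≤ 2 * (1 + p * x ^ (m + 1)) / (κ * x) + A * (κ * x) ^ (m - j) + 1 := by linarith [hsC j]
      _ ≤ 2 * (x ^ (m + 1) + p * x ^ (m + 1)) / (κ * x) + A * x ^ m + x ^ m := by
        gcongr
        exacts [hpow _, hpow _]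
      _ = (2 * (1 + p) / κ + A + 1) * x ^ m := by
        field_simp
        ring
  · rw [show m + 1 - j = m - j + 1 by omega]
    calc 1 + p * x ^ (m + 1) ≤ s j * (κ * x * (A * (κ * x) ^ (m - j)) - A * (κ * x) ^ (m - j)) :=
          hs j
      _ = s j * (A * (κ * x) ^ (m - j + 1) - A * (κ * x) ^ (m - j)) := by ring

lemma mul_two_rpow_neg_le {n p s : ℕ} {a b w : ℝ} (hn : 1 ≤ n) (hw : s * b + 1 ≤ w)
    (hab : 1 + p * Real.logb 2 n ≤ s * (a - b)) :
    (n : ℝ) * 2 ^ (-w) ≤ (2 ^ (-b)) ^ s * (n : ℝ) - n.choose p * (2 ^ (-a)) ^ s := by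
  have hn : (1 : ℝ) ≤ n := mod_cast hn
  have hchoose : (n.choose p : ℝ) ≤ 2 ^ (p * Real.logb 2 n) := by
    rw [mul_comm, Real.rpow_mul zero_le_two, Real.rpow_logb zero_lt_two (by norm_num)
      (by linarith), Real.rpow_natCast]
    exact mod_cast Nat.choose_le_pow n p
  have hpow (u : ℝ) : ((2 : ℝ) ^ (-u)) ^ s = 2 ^ (-(s * u)) := by
    rw [← Real.rpow_natCast, ← Real.rpow_mul zero_le_two]
    ring_nf
  have hhalf : (2 : ℝ) ^ (-(s * b) - 1) = 2 ^ (-(s * b)) / 2 := Real.rpow_sub_one two_ne_zero _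
  have hbad : n.choose p * (2 : ℝ) ^ (-(s * a)) ≤ 2 ^ (-(s * b)) / 2 * n :=
    calc n.choose p * (2 : ℝ) ^ (-(s * a))
        ≤ 2 ^ (p * Real.logb 2 n) * 2 ^ (-(s * a)) := by gcongr
      _ = 2 ^ (p * Real.logb 2 n + -(s * a)) := (Real.rpow_add zero_lt_two _ _).symm
      _ ≤ 2 ^ (-(s * b) - 1) := Real.rpow_le_rpow_of_exponent_le one_le_two (by linarith)
      _ ≤ 2 ^ (-(s * b)) / 2 * n := by
        rw [hhalf]
        exact le_mul_of_one_le_right (by positivity) hn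
  have hgood : n * (2 : ℝ) ^ (-w) ≤ 2 ^ (-(s * b)) / 2 * n := by
    rw [← hhalf, mul_comm]
    gcongr
    · exact one_le_two
    · linarith
  rw [hpow, hpow]
  linarith

lemma fFun_succ_eq {r : ℕ} (hr : 1 ≤ r) (ω : ℕ → ℝ) (n : ℕ) :
    fFun (r + 1) ω n
      = n * 2 ^ (-(ω n * (Real.logb 2 n ^ (1 / (r : ℝ))) ^ (r - 1))) := by
  have hlog : 0 ≤ Real.logb 2 n :=
    div_nonneg (Real.log_natCast_nonneg n) (Real.log_nonneg one_le_two)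
  rw [fFun, ← Real.rpow_natCast, ← Real.rpow_mul hlog, Nat.cast_sub hr]
  congr 5
  push_cast
  rw [add_sub_cancel_right]
  ring

lemma eventually_not_cliqueFree_of_le_card_cliqueTuples {p r k : ℕ} (hp : 0 < p) (hr : 1 ≤ r)
    {ω : ℕ → ℝ} (hω : Tendsto ω atTop atTop) {c ϑ : ℝ} (hc : 0 < c) (hϑ : 0 < ϑ) :
    ∀ᶠ n : ℕ in atTop, ∀ G : SimpleGraph (Fin n), LargeSetsSpanClique G p (fFun (r + 1) ω n) →
      LargeSetsSpanClique G k ((n : ℝ) ^ (1 - ϑ)) →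
      c * (n : ℝ) ^ (r + 1) ≤ #(cliqueTuples G (r + 1)) → ¬ G.CliqueFree (p * r + k) := by
  have hlog : Tendsto (fun n : ℕ => Real.logb 2 (n : ℝ)) atTop atTop :=
    (Real.tendsto_logb_atTop one_lt_two).comp tendsto_natCast_atTop_atTop
  have hroot : Tendsto (fun n : ℕ => Real.logb 2 (n : ℝ) ^ (1 / (r : ℝ))) atTop atTop :=
    (tendsto_rpow_atTop (by positivity)).comp hlog
  obtain ⟨A, hA, hAc⟩ : ∃ A : ℝ, 0 < A ∧ -A ≤ Real.logb 2 c :=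
    ⟨max 1 (-Real.logb 2 c), by positivity, neg_le.1 (le_max_right _ _)⟩
  obtain ⟨C, hC⟩ := exists_exponents p hr hA hϑ
  filter_upwards [hroot.eventually hC, hω.eventually_ge_atTop C, hlog.eventually_ge_atTop 0,
    eventually_ge_atTop 1] with n ⟨a, s, har, ha0, has⟩ hωn hL hn G hGp hGk hG hfree
  have : Nonempty (Fin n) := ⟨⟨0, hn⟩⟩
  have hn0 : (0 : ℝ) < n := mod_cast hn
  have hx : (Real.logb 2 n ^ (1 / (r : ℝ))) ^ r = Real.logb 2 n := by
    rw [one_div, Real.rpow_inv_natCast_pow hL (by omega)]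
  have hpow (u : ℝ) : (n : ℝ) ^ u = 2 ^ (Real.logb 2 n * u) := by
    rw [Real.rpow_mul zero_le_two, Real.rpow_logb zero_lt_two (by norm_num) hn0]
  have hlast : (n : ℝ) ^ (1 - ϑ) ≤ 2 ^ (-a 0) * n := by
    rw [sub_eq_neg_add, Real.rpow_add_one hn0.ne', hpow]
    rw [hx] at ha0
    gcongr
    · exact one_le_two
    · linarith
  have hround : ∀ j < r, fFun (r + 1) ω n
      ≤ (2 ^ (-a (j + 1))) ^ s j * (n : ℝ) - n.choose p * (2 ^ (-a j)) ^ s j := by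
    intro j hj
    obtain ⟨hsmall, hlarge⟩ := has j hj
    rw [fFun_succ_eq hr]
    refine mul_two_rpow_neg_le hn (hsmall.trans ?_) (hx ▸ hlarge)
    gcongr
  have hdense : 2 ^ (-a r) * (n : ℝ) ^ (r + 1) ≤ #(cliqueTuples G (r + 1)) := by
    refine le_trans ?_ hG
    gcongr
    rw [har]
    exact (Real.le_logb_iff_rpow_le one_lt_two hc).1 hAc
  obtain ⟨K, hK, -⟩ := exists_isNClique_of_dense_cliqueTuples (δ := fun j => (2 : ℝ) ^ (-a j))
    (s := s) hp (fun j => by positivity) hGp hGk (by simpa using hlast) (by simpa using hround)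
    Subset.rfl (by simpa using hdense)
  exact hfree K hK

end Parameters

section RamseyTuranNumber

variable {W : Type*} {n k : ℕ} {m : ℝ} {H : SimpleGraph W} {G : SimpleGraph (Fin n)}

lemma free_top_iff_cliqueFree : (⊤ : SimpleGraph (Fin k)).Free G ↔ G.CliqueFree k := by
  rw [← SimpleGraph.cliqueFree_iff_top_free, Fintype.card_fin]

lemma two_mul_ncard_edgeSet_le (G : SimpleGraph (Fin n)) : 2 * G.edgeSet.ncard ≤ n ^ 2 := by
  simpa [card_cliqueTuples_two] using card_le_univ (cliqueTuples G 2)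

lemma bddAbove_ncard_edgeSet (n : ℕ) (H : SimpleGraph W) (m : ℝ) :
    BddAbove {e : ℕ | ∃ G : SimpleGraph (Fin n),
      H.Free G ∧ (G.indepNum : ℝ) < m ∧ G.edgeSet.ncard = e} := by
  refine ⟨n ^ 2, ?_⟩
  rintro _ ⟨G, -, -, rfl⟩
  linarith [two_mul_ncard_edgeSet_le G]

lemma ncard_edgeSet_le_rtNum (hG : H.Free G) (hα : (G.indepNum : ℝ) < m) :
    G.edgeSet.ncard ≤ rtNum n H m :=
  le_csSup (bddAbove_ncard_edgeSet n H m) ⟨G, hG, hα, rfl⟩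

lemma rtNum_le {B : ℝ} (hB : 0 ≤ B)
    (h : ∀ G : SimpleGraph (Fin n), H.Free G → (G.indepNum : ℝ) < m → (G.edgeSet.ncard : ℝ) ≤ B) :
    (rtNum n H m : ℝ) ≤ B := by
  obtain hempty | hne := Set.eq_empty_or_nonempty {e : ℕ | ∃ G : SimpleGraph (Fin n),
    H.Free G ∧ (G.indepNum : ℝ) < m ∧ G.edgeSet.ncard = e}
  · rw [rtNum, hempty]
    simpa using hB
  · obtain ⟨G, hG, hα, he⟩ := Nat.sSup_mem hne (bddAbove_ncard_edgeSet n H m)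
    rw [rtNum, ← he]
    exact h G hG hα

lemma rtNum_div_sq_le_half (n : ℕ) (H : SimpleGraph W) (m : ℝ) :
    (rtNum n H m : ℝ) / (n : ℝ) ^ 2 ≤ 1 / 2 := by
  refine div_le_of_le_mul₀ (by positivity) (by norm_num) (rtNum_le (by positivity) fun G _ _ => ?_)
  have hle : (2 * G.edgeSet.ncard : ℝ) ≤ n ^ 2 := mod_cast two_mul_ncard_edgeSet_le G
  linarith

lemma isBoundedUnder_le_rtNum_div_sq (H : SimpleGraph W) (g : ℕ → ℝ) :
    IsBoundedUnder (· ≤ ·) atTop fun n : ℕ => (rtNum n H (g n) : ℝ) / (n : ℝ) ^ 2 :=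
  isBoundedUnder_of ⟨1 / 2, fun n => rtNum_div_sq_le_half n H (g n)⟩

lemma isBoundedUnder_ge_rtNum_div_sq (H : SimpleGraph W) (g : ℕ → ℝ) :
    IsBoundedUnder (· ≥ ·) atTop fun n : ℕ => (rtNum n H (g n) : ℝ) / (n : ℝ) ^ 2 :=
  isBoundedUnder_of ⟨0, fun n => by positivity⟩

lemma lowerDensity_le_upperDensity (H : SimpleGraph W) (g : ℕ → ℝ) :
    lowerDensity H g ≤ upperDensity H g :=
  liminf_le_limsup (isBoundedUnder_le_rtNum_div_sq H g) (isBoundedUnder_ge_rtNum_div_sq H g)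

lemma hasDensity_of_le_of_le {g : ℕ → ℝ} {c : ℝ} (hlower : c ≤ lowerDensity H g)
    (hupper : upperDensity H g ≤ c) : HasDensity H g c :=
  have hle := lowerDensity_le_upperDensity H g
  ⟨hupper.antisymm (hlower.trans hle), (hle.trans hupper).antisymm hlower⟩

end RamseyTuranNumber

section UpperBound

variable {p q r : ℕ} {ω : ℕ → ℝ}

lemma eventually_not_cliqueFree_of_le_ncard_edgeSet (hp : 0 < p) (hr : 1 ≤ r)
    (hω : Tendsto ω atTop atTop) (hgap : RamseyGap p (fFun (r + 1) ω)) {σ : ℝ} (hσ : 0 ≤ σ)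
    (hrσ : r * σ < 1) :
    ∀ᶠ n : ℕ in atTop, ∀ G : SimpleGraph (Fin n), G.indepNum < invRamsey p (fFun (r + 1) ω n) →
      (1 - σ) * (n : ℝ) ^ 2 ≤ 2 * G.edgeSet.ncard → ¬ G.CliqueFree (p * (r + 1) - 1) := by
  obtain ⟨ϑ, hϑ, hgap⟩ := hgap
  have hc : 0 < (1 - r * σ) ^ (r + 1) := pow_pos (by linarith) _
  filter_upwards [hgap,
    eventually_not_cliqueFree_of_le_card_cliqueTuples (k := p - 1) hp hr hω hc hϑ]
    with n hgap hclique G hα hG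
  rw [show p * (r + 1) - 1 = p * r + (p - 1) by rw [Nat.mul_succ]; omega]
  refine hclique G (largeSetsSpanClique_of_indepNum_lt_invRamsey hα)
    ((largeSetsSpanClique_of_indepNum_lt hα).mono hgap.le) ?_
  simpa using one_sub_pow_mul_card_pow_le_card_cliqueTuples (G := G) hσ hrσ.le
    (by simpa [card_cliqueTuples_two] using hG)

theorem upperDensity_le {k : ℕ} (hp : 0 < p) (hq : 2 ≤ q) (hk : k ≤ p * q - 1)
    (hω : Tendsto ω atTop atTop) (hgap : RamseyGap p (fFun q ω)) {g : ℕ → ℝ}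
    (hg : ∀ᶠ n in atTop, g n ≤ invRamsey p (fFun q ω n)) :
    upperDensity (⊤ : SimpleGraph (Fin k)) g ≤ 1 / 2 * (1 - 1 / ((q : ℝ) - 1)) := by
  obtain ⟨r, rfl⟩ : ∃ r, q = r + 1 := ⟨q - 1, by omega⟩
  have hr : (1 : ℝ) ≤ r := mod_cast (by omega : 1 ≤ r)
  rw [Nat.cast_succ, add_sub_cancel_right]
  refine le_of_forall_gt_imp_ge_of_dense fun a ha => ?_
  have hrinv : r * (1 / (r : ℝ)) = 1 := mul_one_div_cancel (by positivity)
  have ha0 : 0 ≤ a := by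
    have : 1 / (r : ℝ) ≤ 1 := div_le_one_of_le₀ hr (by positivity)
    linarith
  have hrσ : r * max 0 (1 - 2 * a) < 1 := by
    rw [mul_max_of_nonneg _ _ (by positivity), mul_zero, max_lt_iff]
    exact ⟨one_pos, by nlinarith⟩
  refine limsup_le_of_le (isBoundedUnder_ge_rtNum_div_sq _ g).isCoboundedUnder_le ?_
  filter_upwards [hg, eventually_not_cliqueFree_of_le_ncard_edgeSet hp (by omega) hω hgap
    (le_max_left _ _) hrσ] with n hgn hn
  refine div_le_of_le_mul₀ (by positivity) ha0 (rtNum_le (by positivity) fun G hG hα => ?_)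
  by_contra! hedges
  refine hn G (mod_cast hα.trans_le hgn) ?_ ((free_top_iff_cliqueFree.1 hG).mono hk)
  calc (1 - max 0 (1 - 2 * a)) * (n : ℝ) ^ 2 ≤ 2 * a * (n : ℝ) ^ 2 := by
        gcongr
        linarith [le_max_right 0 (1 - 2 * a)]
    _ ≤ 2 * (G.edgeSet.ncard : ℝ) := by linarith

end UpperBound

section LowerBound

variable {C W : Type*} {H : SimpleGraph W}

/-- The join of copies of `H` indexed by `C`: vertices in different copies are always adjacent. -/
def joinCopies (C : Type*) (H : SimpleGraph W) : SimpleGraph (C × W) :=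
  (⊤ : SimpleGraph C).comap Prod.fst ⊔ H.comap Prod.snd

lemma joinCopies_adj {x y : C × W} :
    (joinCopies C H).Adj x y ↔ x.1 ≠ y.1 ∨ H.Adj x.2 y.2 :=
  Iff.rfl

lemma cliqueFree_joinCopies [Fintype C] {t : ℕ} (hH : H.CliqueFree (t + 1)) :
    (joinCopies C H).CliqueFree (Fintype.card C * t + 1) := by
  classical
  intro S hS
  obtain ⟨c, -, hc⟩ := exists_lt_card_fiber_of_mul_lt_card_of_maps_to (s := S) (t := univ)
    (f := Prod.fst) (n := t) (fun _ _ => mem_univ _) (by rw [hS.card_eq, card_univ]; omega)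
  have hcopy : H.IsNClique #{x ∈ S | x.1 = c} (image Prod.snd {x ∈ S | x.1 = c}) := by
    refine ⟨?_, card_image_of_injOn ?_⟩
    · simp only [SimpleGraph.isClique_iff, Set.Pairwise, coe_image, coe_filter,
        Set.forall_mem_image]
      rintro x ⟨hx, hxc⟩ y ⟨hy, hyc⟩ hxy
      exact (joinCopies_adj.1 (hS.isClique hx hy fun h => hxy (h ▸ rfl))).resolve_left
        (not_not.2 (hxc.trans hyc.symm))
    · intro x hx y hy hxy
      exact Prod.ext ((mem_filter.1 hx).2.trans (mem_filter.1 hy).2.symm) hxy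
  exact hcopy.not_cliqueFree (hH.mono hc)

lemma indepNum_joinCopies_le [Finite C] [Finite W] :
    (joinCopies C H).indepNum ≤ H.indepNum := by
  classical
  obtain ⟨S, hS⟩ := (joinCopies C H).exists_isNIndepSet_indepNum
  have hnonadj : ∀ x ∈ S, ∀ y ∈ S, x.1 = y.1 ∧ ¬ H.Adj x.2 y.2 := by
    intro x hx y hy
    obtain rfl | hxy := eq_or_ne x y
    · exact ⟨rfl, H.irrefl⟩
    · simpa [joinCopies_adj] using hS.isIndepSet hx hy hxy
  have hinj : Set.InjOn Prod.snd (S : Set (C × W)) := fun x hx y hy hxy =>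
    Prod.ext (hnonadj x hx y hy).1 hxy
  rw [← hS.card_eq, ← card_image_of_injOn hinj]
  refine SimpleGraph.IsIndepSet.card_le_indepNum ?_
  simp only [SimpleGraph.isIndepSet_iff, Set.Pairwise, coe_image, Set.forall_mem_image]
  exact fun x hx y hy _ => (hnonadj x hx y hy).2

lemma card_sq_le_two_mul_ncard_edgeSet_comap_joinCopies {V : Type*} [Fintype V] [Fintype W]
    (e : V ↪ C × W) :
    Fintype.card V ^ 2 ≤ 2 * ((joinCopies C H).comap e).edgeSet.ncard
      + Fintype.card V * Fintype.card W := by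
  classical
  have hsame (y : Fin 2 → V) (hy : y ∈ (cliqueTuples ((joinCopies C H).comap e) 2)ᶜ) :
      (e (y 0)).1 = (e (y 1)).1 := by
    by_contra hne
    refine mem_compl.1 hy (mem_cliqueTuples.2 ?_)
    simp [IsCliqueTuple, Pairwise, joinCopies_adj, Fin.forall_fin_two, hne, Ne.symm hne]
  have hnonadj : #(cliqueTuples ((joinCopies C H).comap e) 2)ᶜ ≤ Fintype.card (V × W) := by
    refine card_le_card_of_injOn (t := univ) (fun y : Fin 2 → V => (y 0, (e (y 1)).2))
      (fun _ _ => mem_coe.2 (mem_univ _)) fun y hy z hz hyz => ?_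
    obtain ⟨hy0, hy1⟩ := Prod.ext_iff.1 hyz
    have hyz1 : e (y 1) = e (z 1) :=
      Prod.ext (by rw [← hsame y hy, ← hsame z hz, show y 0 = z 0 from hy0]) hy1
    ext i
    fin_cases i
    exacts [hy0, e.injective hyz1]
  calc Fintype.card V ^ 2 = Fintype.card (Fin 2 → V) := by simp
    _ = #(cliqueTuples ((joinCopies C H).comap e) 2)
        + #(cliqueTuples ((joinCopies C H).comap e) 2)ᶜ := (card_add_card_compl _).symm
    _ ≤ _ := by
      rw [card_cliqueTuples_two, ← Fintype.card_prod]
      gcongr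

theorem le_rtNum {n r t k : ℕ} (hr : 1 ≤ r) (ht : 1 ≤ t) (hk : r * t < k) {m : ℝ}
    (hm : (invRamsey (t + 1) ((n : ℝ) / r) : ℝ) < m) :
    1 / 2 * ((1 - 1 / (r : ℝ)) * (n : ℝ) ^ 2 - n) ≤ rtNum n (⊤ : SimpleGraph (Fin k)) m := by
  have hr0 : (0 : ℝ) < r := mod_cast hr
  obtain ⟨H, hH, hHα⟩ :=
    exists_cliqueFree_indepNum_eq_invRamsey (t := t + 1) (by omega) ((n : ℝ) / r)
  obtain ⟨e⟩ : Nonempty (Fin n ↪ Fin r × Fin ⌈(n : ℝ) / r⌉₊) := by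
    refine Function.Embedding.nonempty_of_card_le ?_
    simpa using (Nat.cast_le (α := ℝ)).1 (by
      push_cast
      exact (div_le_iff₀' hr0).1 (Nat.le_ceil ((n : ℝ) / r)))
  have hfree : ((joinCopies (Fin r) H).comap e).CliqueFree k := by
    refine ((cliqueFree_joinCopies hH).comap ⟨(SimpleGraph.Embedding.comap e _).toCopy⟩).mono ?_
    simpa using hk
  have hα : (((joinCopies (Fin r) H).comap e).indepNum : ℝ) < m := by
    refine lt_of_le_of_lt ?_ hm
    rw [← hHα]
    exact mod_cast (indepNum_comap_le _ e).trans indepNum_joinCopies_le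
  have hrt : (((joinCopies (Fin r) H).comap e).edgeSet.ncard : ℝ)
      ≤ rtNum n (⊤ : SimpleGraph (Fin k)) m :=
    mod_cast ncard_edgeSet_le_rtNum (free_top_iff_cliqueFree.2 hfree) hα
  have hedges : (n : ℝ) ^ 2 ≤ 2 * ((joinCopies (Fin r) H).comap e).edgeSet.ncard
      + n * ⌈(n : ℝ) / r⌉₊ := by
    have := card_sq_le_two_mul_ncard_edgeSet_comap_joinCopies (H := H) e
    rw [Fintype.card_fin, Fintype.card_fin] at this
    exact mod_cast this
  have hceil : n * (⌈(n : ℝ) / r⌉₊ : ℝ) ≤ n * (n / r + 1) := by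
    gcongr
    exact (Nat.ceil_lt_add_one (by positivity)).le
  calc 1 / 2 * ((1 - 1 / (r : ℝ)) * (n : ℝ) ^ 2 - n) = 1 / 2 * (n ^ 2 - n * (n / r + 1)) := by ring
    _ ≤ (rtNum n (⊤ : SimpleGraph (Fin k)) m : ℝ) := by linarith

theorem le_lowerDensity {r t k : ℕ} (hr : 1 ≤ r) (ht : 1 ≤ t) (hk : r * t < k) {g : ℕ → ℝ}
    (hg : ∀ᶠ n : ℕ in atTop, (invRamsey (t + 1) ((n : ℝ) / r) : ℝ) < g n) :
    1 / 2 * (1 - 1 / (r : ℝ)) ≤ lowerDensity (⊤ : SimpleGraph (Fin k)) g := by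
  refine le_of_forall_pos_sub_le fun ε hε => ?_
  refine le_liminf_of_le (isBoundedUnder_le_rtNum_div_sq _ g).isCoboundedUnder_ge ?_
  filter_upwards [hg, tendsto_natCast_atTop_atTop.eventually_ge_atTop (1 / ε),
    eventually_ge_atTop 1] with n hgn hn hn1
  have hn0 : (0 : ℝ) < n := mod_cast hn1
  have hnε : (n : ℝ) ≤ ε * n * n := le_mul_of_one_le_left hn0.le ((div_le_iff₀' hε).1 hn)
  rw [le_div_iff₀ (by positivity)]
  calc (1 / 2 * (1 - 1 / (r : ℝ)) - ε) * (n : ℝ) ^ 2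
      ≤ 1 / 2 * ((1 - 1 / (r : ℝ)) * (n : ℝ) ^ 2 - n) := by linarith
    _ ≤ (rtNum n (⊤ : SimpleGraph (Fin k)) (g n) : ℝ) := le_rtNum hr ht hk hgn

end LowerBound

lemma le_div_and_mul_div_lt {p q i : ℕ} (hq : 2 ≤ q) (hi : 1 ≤ i) (hip : i ≤ p - 1) :
    p ≤ (p * q - i - 1) / (q - 1) ∧ (q - 1) * ((p * q - i - 1) / (q - 1)) < p * q - i := by
  obtain ⟨r, rfl⟩ : ∃ r, q = r + 1 := ⟨q - 1, by omega⟩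
  rw [Nat.add_sub_cancel, Nat.mul_succ]
  have : r * ((p * r + p - i - 1) / r) ≤ p * r + p - i - 1 := Nat.mul_div_le _ _
  exact ⟨(Nat.le_div_iff_mul_le (by omega)).2 (by omega), by omega⟩

end RamseyTuran

theorem mainTheorem4_general (p q : ℕ) (hp : 2 ≤ p) (hq : 2 ≤ q)
    (ω : ℕ → ℝ) (hω : Filter.Tendsto ω Filter.atTop Filter.atTop) :
    (RamseyTuran.RamseyGap p (RamseyTuran.fFun q ω) →
      RamseyTuran.upperDensity (⊤ : SimpleGraph (Fin (p * q - 1)))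
          (fun n => (RamseyTuran.invRamsey p (RamseyTuran.fFun q ω n) : ℝ))
        ≤ 1 / 2 * (1 - 1 / ((q : ℝ) - 1))) ∧
    (∀ i t : ℕ, 1 ≤ i → i ≤ p - 1 → t = (p * q - i - 1) / (q - 1) →
      p ≤ t ∧
      ∀ g : ℕ → ℝ,
        (∀ᶠ n : ℕ in Filter.atTop,
          (RamseyTuran.invRamsey (t + 1) ((n : ℝ) / ((q : ℝ) - 1)) : ℝ) < g n ∧
          g n ≤ (RamseyTuran.invRamsey p (RamseyTuran.fFun q ω n) : ℝ)) →
        1 / 2 * (1 - 1 / ((q : ℝ) - 1))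
            ≤ RamseyTuran.lowerDensity (⊤ : SimpleGraph (Fin (p * q - i))) g ∧
        (RamseyTuran.RamseyGap p (RamseyTuran.fFun q ω) →
          RamseyTuran.HasDensity (⊤ : SimpleGraph (Fin (p * q - i))) g
            (1 / 2 * (1 - 1 / ((q : ℝ) - 1))))) := by
  have hp0 : 0 < p := by omega
  have hcast : ((q - 1 : ℕ) : ℝ) = q - 1 := by
    rw [Nat.cast_sub (by omega), Nat.cast_one]
  refine ⟨fun hgap => RamseyTuran.upperDensity_le hp0 hq le_rfl hω hgap
    (.of_forall fun _ => le_rfl), ?_⟩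
  rintro i t hi hip rfl
  obtain ⟨hpt, hmul⟩ := RamseyTuran.le_div_and_mul_div_lt hq hi hip
  refine ⟨hpt, fun g hg => ?_⟩
  have hlower : 1 / 2 * (1 - 1 / ((q : ℝ) - 1))
      ≤ RamseyTuran.lowerDensity (⊤ : SimpleGraph (Fin (p * q - i))) g := by
    rw [← hcast] at hg ⊢
    exact RamseyTuran.le_lowerDensity (by omega) (by omega) hmul (hg.mono fun _ => And.left)
  refine ⟨hlower, fun hgap => RamseyTuran.hasDensity_of_le_of_le hlower ?_⟩
  exact RamseyTuran.upperDensity_le hp0 hq (by omega) hω hgap (hg.mono fun _ => And.right)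

theorem mainTheorem4 (p q : ℕ) (hp : 3 ≤ p) (hq : 2 ≤ q)
    (ω : ℕ → ℝ) (hω : Filter.Tendsto ω Filter.atTop Filter.atTop) :
    -- (a)
    (RamseyTuran.RamseyGap p (RamseyTuran.fFun q ω) →
      RamseyTuran.upperDensity (⊤ : SimpleGraph (Fin (p * q - 1)))
          (fun n => (RamseyTuran.invRamsey p (RamseyTuran.fFun q ω n) : ℝ))
        ≤ 1 / 2 * (1 - 1 / ((q : ℝ) - 1))) ∧
    -- (b)
    (∀ i t : ℕ, 1 ≤ i → i ≤ p - 1 → t = (p * q - i - 1) / (q - 1) →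
      p ≤ t ∧
      ∀ g : ℕ → ℝ,
        (∀ᶠ n : ℕ in Filter.atTop,
          (RamseyTuran.invRamsey (t + 1) ((n : ℝ) / ((q : ℝ) - 1)) : ℝ) < g n ∧
          g n ≤ (RamseyTuran.invRamsey p (RamseyTuran.fFun q ω n) : ℝ)) →
        1 / 2 * (1 - 1 / ((q : ℝ) - 1))
            ≤ RamseyTuran.lowerDensity (⊤ : SimpleGraph (Fin (p * q - i))) g ∧
        (RamseyTuran.RamseyGap p (RamseyTuran.fFun q ω) →
          RamseyTuran.HasDensity (⊤ : SimpleGraph (Fin (p * q - i))) g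
            (1 / 2 * (1 - 1 / ((q : ℝ) - 1))))) :=
  mainTheorem4_general p q (by omega) hq ω hω
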